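/- For a finite simple graph $H$ with vertex set $V$, $|V|\ge 2$, let $$b(H)=\min\Bigl\{\sum_{uv\in E(H)}|x_u-x_v| \;:\; x\in\mathbb{R}^V,\ \sum_{v\in V}x_v=0,\ \sum_{v\in V}|x_v|=1\Bigr\},$$ and let $H^c$ denote the complement of $H$. Let $G$ be a connected simple graph on $n\ge 2$ vertices. Then $$\frac12 < b(G)+b(G^c)\le \frac n2,$$ and $b(G)+b(G^c)=\frac n2$ holds if and only if $G$ is isomorphic to the complete graph $K_n$. -/

import Mathlib

open Classical in
/-- The `ℓ₁` objective `∑_{uv ∈ E(G)} |x_u - x_v|`, each (unordered) edge being counted once. -/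
noncomputable def l1Objective {V : Type*} [Fintype V] (G : SimpleGraph V) (x : V → ℝ) : ℝ :=
  ∑ e ∈ G.edgeFinset, Sym2.lift ⟨fun u v => |x u - x v|, fun u v => abs_sub_comm (x u) (x v)⟩ e

/-- The feasible vectors: coordinate sum `0` and `ℓ₁`-norm `1`. -/
def l1Feasible (V : Type*) [Fintype V] : Set (V → ℝ) :=
  {x | ∑ v, x v = 0 ∧ ∑ v, |x v| = 1}

/-- The `ℓ₁`-Fiedler value `b(G)`: the least value of the objective on the feasible vectors.
The minimum is attained when there are at least two vertices, see `l1Fiedler_isLeast`. -/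
noncomputable def l1Fiedler {V : Type*} [Fintype V] (G : SimpleGraph V) : ℝ :=
  sInf (l1Objective G '' l1Feasible V)

theorem l1Objective_continuous {V : Type*} [Fintype V] (G : SimpleGraph V) :
    Continuous (l1Objective G) := by
  unfold l1Objective
  refine continuous_finsetSum _ fun e _ => ?_
  induction e using Sym2.ind with
  | _ u v => simp only [Sym2.lift_mk]; fun_prop

theorem l1Feasible_isCompact (V : Type*) [Fintype V] : IsCompact (l1Feasible V) := by
  refine Metric.isCompact_of_isClosed_isBounded ?_ ?_
  · exact (isClosed_eq (by fun_prop) continuous_const).inter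
      (isClosed_eq (by fun_prop) continuous_const)
  · refine (Metric.isBounded_closedBall (x := (0 : V → ℝ)) (r := 1)).subset ?_
    intro x hx
    rw [mem_closedBall_zero_iff, pi_norm_le_iff_of_nonneg zero_le_one]
    intro v
    rw [Real.norm_eq_abs, ← hx.2]
    exact Finset.single_le_sum (f := fun v => |x v|) (fun _ _ => abs_nonneg _) (Finset.mem_univ v)

theorem l1Feasible_nonempty (V : Type*) [Fintype V] [Nontrivial V] : (l1Feasible V).Nonempty := by
  classical
  obtain ⟨u, v, huv⟩ := exists_pair_ne V
  refine ⟨fun w => (if w = u then 1 / 2 else 0) - (if w = v then 1 / 2 else 0), ?_, ?_⟩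
  · simp
  · have h : ∀ w : V, |(if w = u then (1 / 2 : ℝ) else 0) - (if w = v then 1 / 2 else 0)|
        = (if w = u then 1 / 2 else 0) + (if w = v then 1 / 2 else 0) := by
      intro w
      by_cases h1 : w = u
      · subst h1; simp [huv]
      · by_cases h2 : w = v
        · subst h2; simp [h1]
        · simp [h1, h2]
    simp only [h, Finset.sum_add_distrib]
    simp
    norm_num

theorem l1Fiedler_isLeast {V : Type*} [Fintype V] [Nontrivial V] (G : SimpleGraph V) :
    IsLeast (l1Objective G '' l1Feasible V) (l1Fiedler G) :=
  ((l1Feasible_isCompact V).image (l1Objective_continuous G)).isLeast_sInf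
    ((l1Feasible_nonempty V).image _)

/-!
The value `b(G)` is, up to the factor `n / 2`, the smallest density of a cut of `G`:
`b(G) = (n / 2) * min_S d_G(S, Sᶜ)` over nonempty proper `S` (`l1Fiedler_le_edgeDensity` and
`exists_edgeDensity_le_l1Fiedler`). The centred indicator of `S` gives `≤`. For `≥`, an inequality
`∑ w u v * |x u - x v| ≥ 0` follows from its special cases for indicators by integrating over the
superlevel sets of `x` (`sum_mul_abs_sub_nonneg`), and `∑_{u, v} |x u - x v| ≥ n * ∑ |x u|` when
`∑ x u = 0`.

Since `d_G(S, Sᶜ) + d_{Gᶜ}(S, Sᶜ) = 1`, using the same `S` for both graphs gives the upper bound,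
and equality forces all cuts of `G` to have the same density. Comparing the cuts around `{u}`, `{v}`
and `{u, v}` for nonadjacent `u ≠ v` then makes that density zero, which is impossible in a
connected graph; so `G` is complete.

For the lower bound let `T` be optimal for `G` and `S` for `Gᶜ`. Let `P` be the set of unordered
pairs separated by both `S` and `T`. Each of them is an edge of `G` crossing the cut `T` or an edge
of `Gᶜ` crossing the cut `S`, and `n * |P|` exceeds both `|S||Sᶜ|` and `|T||Tᶜ|`
(`mul_add_mul_lt_card_mul`). Hence `d_G(T, Tᶜ) + d_{Gᶜ}(S, Sᶜ) > 1 / n`.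
-/

/-! ### Sums of absolute differences and level sets -/

/-- A symmetric weighted sum of differences is nonnegative as soon as the total weight across every
cut is: the sum is an integral, over the level `t`, of the weight of the cut `{u | t < x u}`. -/
theorem sum_mul_abs_sub_nonneg {V : Type*} [Fintype V] [DecidableEq V] (w : V → V → ℝ)
    (hsymm : ∀ u v, w u v = w v u) (hcut : ∀ S : Finset V, 0 ≤ ∑ u ∈ S, ∑ v ∈ Sᶜ, w u v)
    (x : V → ℝ) : 0 ≤ ∑ u, ∑ v, w u v * |x u - x v| := by
  have key : 0 ≤ ∑ u, ∑ v, w u v * max (x u - x v) 0 := by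
    have hint : ∀ u v : V, MeasureTheory.Integrable
        (fun t : ℝ => w u v * (Set.Ico (x v) (x u)).indicator 1 t) := fun u v =>
      ((MeasureTheory.integrable_indicator_iff measurableSet_Ico).2
        (MeasureTheory.integrableOn_const (by simp) (by simp))).const_mul _
    have hval : ∀ u v : V, ∫ t : ℝ, w u v * (Set.Ico (x v) (x u)).indicator 1 t
        = w u v * max (x u - x v) 0 := fun u v => by
      rw [MeasureTheory.integral_const_mul, MeasureTheory.integral_indicator_one measurableSet_Ico,
        Real.volume_real_Ico]
    have hsum : ∑ u, ∑ v, w u v * max (x u - x v) 0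
        = ∫ t : ℝ, ∑ u, ∑ v, w u v * (Set.Ico (x v) (x u)).indicator 1 t := by
      rw [MeasureTheory.integral_finsetSum _ fun u _ =>
        MeasureTheory.integrable_finsetSum _ fun v _ => hint u v]
      refine Finset.sum_congr rfl fun u _ => ?_
      rw [MeasureTheory.integral_finsetSum _ fun v _ => hint u v]
      exact Finset.sum_congr rfl fun v _ => (hval u v).symm
    rw [hsum]
    refine MeasureTheory.integral_nonneg fun t => ?_
    refine (hcut {u | t < x u}).trans_eq ?_
    rw [Finset.sum_filter]
    refine Finset.sum_congr rfl fun u _ => ?_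
    rw [Finset.compl_filter, Finset.sum_filter]
    split_ifs with hu
    · refine Finset.sum_congr rfl fun v _ => ?_
      by_cases hv : t < x v <;> simp [Set.indicator, hu, hv, not_le.2, not_lt.1]
    · simp [Set.indicator, hu]
  have hswap : ∑ u, ∑ v, w u v * max (x v - x u) 0 = ∑ u, ∑ v, w u v * max (x u - x v) 0 := by
    rw [Finset.sum_comm]
    exact Finset.sum_congr rfl fun u _ => Finset.sum_congr rfl fun v _ => by rw [hsymm]
  have habs : ∀ u v, |x u - x v| = max (x u - x v) 0 + max (x v - x u) 0 := fun u v => by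
    rcases le_total (x u) (x v) with h | h
    · rw [abs_of_nonpos (by linarith), max_eq_right (by linarith), max_eq_left (by linarith)]; ring
    · rw [abs_of_nonneg (by linarith), max_eq_left (by linarith), max_eq_right (by linarith)]; ring
  simp only [habs, mul_add, Finset.sum_add_distrib, hswap]
  linarith

/-- This holds because `n * x u = ∑ v, (x u - x v)` when the sum of `x` is zero. -/
theorem card_mul_sum_abs_le {V : Type*} [Fintype V] {x : V → ℝ} (hx : ∑ v, x v = 0) :
    (Fintype.card V : ℝ) * ∑ u, |x u| ≤ ∑ u, ∑ v, |x u - x v| := by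
  rw [Finset.mul_sum]
  refine Finset.sum_le_sum fun u _ => ?_
  calc (Fintype.card V : ℝ) * |x u| = |∑ v, (x u - x v)| := by
        simp [Finset.sum_sub_distrib, hx, abs_mul]
    _ ≤ _ := Finset.abs_sum_le_sum_abs _ _

/-! ### The `ℓ₁`-Fiedler value as a minimum cut density -/

theorem two_mul_l1Objective {V : Type*} [Fintype V] [DecidableEq V] (G : SimpleGraph V)
    [DecidableRel G.Adj] (x : V → ℝ) :
    2 * l1Objective G x = ∑ u, ∑ v, (if G.Adj u v then 1 else 0) * |x u - x v| := by
  set f : Sym2 V → ℝ :=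
    Sym2.lift ⟨fun u v => |x u - x v|, fun u v => abs_sub_comm (x u) (x v)⟩
  have hdef : l1Objective G x = ∑ e ∈ G.edgeFinset, f e := by
    unfold l1Objective
    congr!
  have h1 : ∑ d : G.Dart, f d.edge = 2 * l1Objective G x := by
    rw [← Finset.sum_fiberwise_of_maps_to (t := G.edgeFinset) (g := SimpleGraph.Dart.edge)
      (fun d _ => SimpleGraph.mem_edgeFinset.2 d.edge_mem), hdef, Finset.mul_sum]
    refine Finset.sum_congr rfl fun e he => ?_
    rw [Finset.sum_congr rfl fun d hd => by rw [(Finset.mem_filter.1 hd).2], Finset.sum_const,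
      G.dart_edge_fiber_card e (SimpleGraph.mem_edgeFinset.1 he)]
    simp
  rw [← h1, ← Fintype.sum_prod_type' (f := fun u v => (if G.Adj u v then (1 : ℝ) else 0) * _)]
  simp only [ite_mul, one_mul, zero_mul]
  rw [← Finset.sum_filter]
  refine Finset.sum_bij (fun d _ => d.toProd) (fun d _ => by simp [d.adj])
    (fun d _ d' _ h => SimpleGraph.Dart.ext _ _ h)
    (fun p hp => ⟨⟨p, (Finset.mem_filter.1 hp).2⟩, Finset.mem_univ _, rfl⟩) (fun d _ => rfl)

theorem sum_adj_eq_card_interedges {V : Type*} (G : SimpleGraph V) [DecidableRel G.Adj]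
    (S T : Finset V) :
    ∑ u ∈ S, ∑ v ∈ T, (if G.Adj u v then (1 : ℝ) else 0) = (G.interedges S T).card := by
  rw [SimpleGraph.interedges_def, Finset.card_filter, Finset.sum_product]
  push_cast
  rfl

theorem card_interedges_comm {V : Type*} (G : SimpleGraph V) [DecidableRel G.Adj]
    (S T : Finset V) : (G.interedges S T).card = (G.interedges T S).card :=
  haveI : Std.Symm G.Adj := ⟨fun _ _ h => h.symm⟩
  Rel.card_interedges_comm S T

/-- The centred indicator of `S`, scaled into the feasible set, witnesses the bound. -/
theorem l1Fiedler_le_edgeDensity {V : Type*} [Fintype V] [DecidableEq V] (G : SimpleGraph V)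
    [DecidableRel G.Adj] {S : Finset V} (hS : S.Nonempty) (hS' : Sᶜ.Nonempty) :
    l1Fiedler G ≤ (Fintype.card V : ℝ) / 2 * G.edgeDensity S Sᶜ := by
  obtain ⟨u₀, hu₀⟩ := hS
  obtain ⟨v₀, hv₀⟩ := hS'
  have : Nontrivial V := ⟨u₀, v₀, fun h => Finset.mem_compl.1 hv₀ (h ▸ hu₀)⟩
  have hs : (0 : ℝ) < S.card := by exact_mod_cast Finset.card_pos.2 ⟨u₀, hu₀⟩
  have ht : (0 : ℝ) < Sᶜ.card := by exact_mod_cast Finset.card_pos.2 ⟨v₀, hv₀⟩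
  have hn : (Fintype.card V : ℝ) = S.card + Sᶜ.card := by
    exact_mod_cast (Finset.card_add_card_compl S).symm
  let x : V → ℝ := fun v => if v ∈ S then 1 / (2 * (S.card : ℝ)) else -(1 / (2 * (Sᶜ.card : ℝ)))
  have hsplit : ∀ f : V → ℝ, ∑ v, f v = ∑ v ∈ S, f v + ∑ v ∈ Sᶜ, f v := fun f =>
    (Finset.sum_add_sum_compl S f).symm
  have hxS : ∀ v ∈ S, x v = 1 / (2 * (S.card : ℝ)) := fun v hv => if_pos hv
  have hxS' : ∀ v ∈ Sᶜ, x v = -(1 / (2 * (Sᶜ.card : ℝ))) := fun v hv =>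
    if_neg (Finset.mem_compl.1 hv)
  have hfeas : x ∈ l1Feasible V := by
    constructor
    · rw [hsplit, Finset.sum_congr rfl hxS, Finset.sum_congr rfl hxS', Finset.sum_const,
        Finset.sum_const, nsmul_eq_mul, nsmul_eq_mul]
      field_simp
      ring
    · rw [hsplit, Finset.sum_congr rfl fun v hv => by rw [hxS v hv],
        Finset.sum_congr (s₁ := Sᶜ) rfl fun v hv => by rw [hxS' v hv], Finset.sum_const,
        Finset.sum_const, nsmul_eq_mul, nsmul_eq_mul, abs_neg, abs_of_pos (by positivity),
        abs_of_pos (by positivity)]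
      field_simp
      norm_num
  refine ((l1Fiedler_isLeast G).2 ⟨x, hfeas, rfl⟩).trans_eq ?_
  set c : ℝ := 1 / (2 * (S.card : ℝ)) + 1 / (2 * (Sᶜ.card : ℝ)) with hc
  have hcpos : 0 < c := by positivity
  have hcut : ∀ A B : Finset V, (∀ u ∈ A, ∀ v ∈ B, |x u - x v| = c) →
      ∑ u ∈ A, ∑ v ∈ B, (if G.Adj u v then 1 else 0) * |x u - x v|
        = (G.interedges A B).card * c := fun A B h => by
    rw [← sum_adj_eq_card_interedges, Finset.sum_mul]
    refine Finset.sum_congr rfl fun u hu => ?_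
    rw [Finset.sum_mul]
    exact Finset.sum_congr rfl fun v hv => by rw [h u hu v hv]
  have hzero : ∀ A B : Finset V, (∀ u ∈ A, ∀ v ∈ B, x u = x v) →
      ∑ u ∈ A, ∑ v ∈ B, (if G.Adj u v then 1 else 0) * |x u - x v| = 0 := fun A B h =>
    Finset.sum_eq_zero fun u hu => Finset.sum_eq_zero fun v hv => by simp [h u hu v hv]
  have hobj : 2 * l1Objective G x = 2 * ((G.interedges S Sᶜ).card * c) := by
    rw [two_mul_l1Objective, hsplit]
    simp only [fun u => hsplit fun v => (if G.Adj u v then 1 else 0) * |x u - x v|,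
      Finset.sum_add_distrib]
    rw [hzero S S fun u hu v hv => by rw [hxS u hu, hxS v hv],
      hzero Sᶜ Sᶜ fun u hu v hv => by rw [hxS' u hu, hxS' v hv],
      hcut S Sᶜ fun u hu v hv => by
        rw [hxS u hu, hxS' v hv, sub_neg_eq_add, abs_of_pos hcpos],
      hcut Sᶜ S fun u hu v hv => by
        rw [hxS' u hu, hxS v hv, abs_sub_comm, sub_neg_eq_add, abs_of_pos hcpos],
      show (G.interedges Sᶜ S).card = (G.interedges S Sᶜ).card from
        card_interedges_comm G _ _]
    ring
  rw [mul_left_cancel₀ two_ne_zero hobj, SimpleGraph.edgeDensity_def, hn, hc]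
  push_cast
  field_simp
  ring

/-- The minimum density of a cut is a lower bound for the `ℓ₁`-Fiedler value; together with
`l1Fiedler_le_edgeDensity` the two agree up to the factor `n / 2`. -/
theorem exists_edgeDensity_le_l1Fiedler {V : Type*} [Fintype V] [DecidableEq V]
    [Nontrivial V] (G : SimpleGraph V) [DecidableRel G.Adj] :
    ∃ S : Finset V, S.Nonempty ∧ Sᶜ.Nonempty ∧
      (Fintype.card V : ℝ) / 2 * G.edgeDensity S Sᶜ ≤ l1Fiedler G := by
  obtain ⟨S, hS, hmin⟩ := Finset.exists_min_image
    (Finset.univ.filter fun S : Finset V => S.Nonempty ∧ Sᶜ.Nonempty)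
    (fun S : Finset V => (G.edgeDensity S Sᶜ : ℚ)) (by
      obtain ⟨u, v, huv⟩ := exists_pair_ne V
      exact ⟨{u}, by simpa using ⟨v, by simpa using huv.symm⟩⟩)
  simp only [Finset.mem_filter, Finset.mem_univ, true_and] at hS hmin
  refine ⟨S, hS.1, hS.2, ?_⟩
  obtain ⟨x, ⟨hx0, hx1⟩, hx⟩ := (l1Fiedler_isLeast G).1
  rw [← hx]
  set ρ : ℝ := ((G.edgeDensity S Sᶜ : ℚ) : ℝ) with hρ
  have hρ0 : 0 ≤ ρ := by rw [hρ]; exact_mod_cast G.edgeDensity_nonneg S Sᶜ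
  have hcut : ∀ T : Finset V, 0 ≤ ∑ u ∈ T, ∑ v ∈ Tᶜ, ((if G.Adj u v then 1 else 0) - ρ) := by
    intro T
    simp only [Finset.sum_sub_distrib, sum_adj_eq_card_interedges, Finset.sum_const, nsmul_eq_mul]
    by_cases hT : T.Nonempty ∧ Tᶜ.Nonempty
    · have hT1 : (0 : ℝ) < T.card := by exact_mod_cast hT.1.card_pos
      have hT2 : (0 : ℝ) < Tᶜ.card := by exact_mod_cast hT.2.card_pos
      have h : ρ ≤ ((G.edgeDensity T Tᶜ : ℚ) : ℝ) := by rw [hρ]; exact_mod_cast hmin T hT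
      rw [SimpleGraph.edgeDensity_def] at h
      push_cast at h
      rw [le_div_iff₀ (by positivity)] at h
      linarith
    · rw [not_and_or, Finset.not_nonempty_iff_eq_empty, Finset.not_nonempty_iff_eq_empty] at hT
      rcases hT with h | h <;> simp [h]
  have h1 := sum_mul_abs_sub_nonneg _
    (fun u v => by simp only [SimpleGraph.adj_comm]) hcut x
  simp only [sub_mul, Finset.sum_sub_distrib, ← two_mul_l1Objective, ← Finset.mul_sum] at h1
  have h2 := card_mul_sum_abs_le hx0
  rw [hx1, mul_one] at h2
  have h3 := mul_le_mul_of_nonneg_left h2 hρ0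
  linarith

/-! ### Two cuts, one in the graph and one in its complement -/

/-- If two cuts divide an `n`-element set into blocks of sizes `a, b` on one side of the first cut
and `c, d` on the other, with `a, c` on one side of the second cut, then the `a * d + b * c` pairs
separated by both are more than the fraction `1 / n` of those separated by the first one. -/
theorem mul_add_mul_lt_card_mul {a b c d : ℕ} (h1 : 0 < a + b) (h2 : 0 < c + d)
    (h3 : 0 < a + c) (h4 : 0 < b + d) :
    (a + b) * (c + d) < (a + b + c + d) * (a * d + b * c) := by
  rcases Nat.eq_zero_or_pos a with rfl | ha
  · have hb : 0 < b := by omega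
    have hc : 0 < c := by omega
    have := Nat.mul_pos hb hc
    nlinarith [Nat.mul_le_mul_left (b * d) hc]
  rcases Nat.eq_zero_or_pos b with rfl | hb
  · have hd : 0 < d := by omega
    have := Nat.mul_pos ha hd
    nlinarith [Nat.mul_le_mul_left (a * c) hd]
  rcases Nat.eq_zero_or_pos c with rfl | hc
  · have hd : 0 < d := by omega
    have := Nat.mul_pos ha hd
    nlinarith [Nat.mul_le_mul_left (b * d) ha]
  rcases Nat.eq_zero_or_pos d with rfl | hd
  · have := Nat.mul_pos hb hc
    nlinarith [Nat.mul_le_mul_left (a * c) hb]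
  -- With all blocks nonempty, the summand `c + d` of `n` pays for `a * c` and `b * d`, and the
  -- summand `a + b ≥ 2` for `a * d` and `b * c`.
  have e1 : a * c ≤ c * (a * d) := by nlinarith [Nat.mul_pos ha hc]
  have e2 : b * d ≤ d * (b * c) := by nlinarith [Nat.mul_pos hb hd]
  have e3 : 0 < a * d := Nat.mul_pos ha hd
  have e4 : 0 < b * c := Nat.mul_pos hb hc
  have e5 : 2 * (a * d + b * c) ≤ (a + b) * (a * d + b * c) :=
    Nat.mul_le_mul_right _ (by omega)
  nlinarith [Nat.zero_le (d * (a * d)), Nat.zero_le (c * (b * c))]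

/-- A cut contains the edges between two opposite pairs of blocks of a finer partition. -/
theorem card_interedges_add_le {V : Type*} [Fintype V] [DecidableEq V] (G : SimpleGraph V)
    [DecidableRel G.Adj] {S A B C D : Finset V}
    (hA : A ⊆ S) (hB : B ⊆ S) (hAB : Disjoint A B) (hC : C ⊆ Sᶜ) (hD : D ⊆ Sᶜ) :
    (G.interedges A D).card + (G.interedges B C).card ≤ (G.interedges S Sᶜ).card := by
  rw [← Finset.card_union_of_disjoint ((G.interedges_disjoint_left hAB _).mono_right
    (G.interedges_mono subset_rfl (Finset.subset_union_left (s₁ := C) (s₂ := D))) |>.mono_left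
    (G.interedges_mono subset_rfl (Finset.subset_union_right (s₁ := C) (s₂ := D))))]
  exact Finset.card_le_card (Finset.union_subset (G.interedges_mono hA hD)
    (G.interedges_mono hB hC))

/-- Cuts of `G` and of its complement, even different ones, have total density above `1 / n`. -/
theorem one_lt_card_mul_edgeDensity_add_compl {V : Type*} [Fintype V] [DecidableEq V]
    (G : SimpleGraph V) [DecidableRel G.Adj] {S T : Finset V}
    (hS : S.Nonempty) (hS' : Sᶜ.Nonempty) (hT : T.Nonempty) (hT' : Tᶜ.Nonempty) :
    (1 : ℝ) < Fintype.card V * (G.edgeDensity T Tᶜ + Gᶜ.edgeDensity S Sᶜ) := by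
  set A := S ∩ T
  set B := S ∩ Tᶜ
  set C := Sᶜ ∩ T
  set D := Sᶜ ∩ Tᶜ
  have dj : ∀ X : Finset V, Disjoint X Xᶜ := fun X => disjoint_compl_right
  have cS : S.card = A.card + B.card := by
    rw [← Finset.card_union_of_disjoint ((dj T).mono Finset.inter_subset_right
      Finset.inter_subset_right), ← Finset.inter_union_distrib_left]; simp
  have cS' : Sᶜ.card = C.card + D.card := by
    rw [← Finset.card_union_of_disjoint ((dj T).mono Finset.inter_subset_right
      Finset.inter_subset_right), ← Finset.inter_union_distrib_left]; simp
  have cT : T.card = A.card + C.card := by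
    rw [← Finset.card_union_of_disjoint ((dj S).mono Finset.inter_subset_left
      Finset.inter_subset_left), ← Finset.union_inter_distrib_right]; simp
  have cT' : Tᶜ.card = B.card + D.card := by
    rw [← Finset.card_union_of_disjoint ((dj S).mono Finset.inter_subset_left
      Finset.inter_subset_left), ← Finset.union_inter_distrib_right]; simp
  have hn : Fintype.card V = A.card + B.card + C.card + D.card := by
    rw [← Finset.card_add_card_compl S, cS, cS']; ring
  have pS := hS.card_pos
  have pS' := hS'.card_pos
  have pT := hT.card_pos
  have pT' := hT'.card_pos
  have arS := mul_add_mul_lt_card_mul (a := A.card) (b := B.card) (c := C.card) (d := D.card)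
    (by omega) (by omega) (by omega) (by omega)
  have arT := mul_add_mul_lt_card_mul (a := A.card) (b := C.card) (c := B.card) (d := D.card)
    (by omega) (by omega) (by omega) (by omega)
  have eT : (G.interedges A D).card + (G.interedges B C).card ≤ (G.interedges T Tᶜ).card := by
    rw [show (G.interedges B C).card = (G.interedges C B).card from
      card_interedges_comm G _ _]
    exact card_interedges_add_le G Finset.inter_subset_right Finset.inter_subset_right
      ((dj S).mono Finset.inter_subset_left Finset.inter_subset_left)
      Finset.inter_subset_right Finset.inter_subset_right
  have eS : (Gᶜ.interedges A D).card + (Gᶜ.interedges B C).card ≤ (Gᶜ.interedges S Sᶜ).card :=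
    card_interedges_add_le Gᶜ Finset.inter_subset_left Finset.inter_subset_left
      ((dj T).mono Finset.inter_subset_right Finset.inter_subset_right)
      Finset.inter_subset_left Finset.inter_subset_left
  have hAD : (G.interedges A D).card + (Gᶜ.interedges A D).card = A.card * D.card :=
    G.card_interedges_add_card_interedges_compl
      ((dj S).mono Finset.inter_subset_left Finset.inter_subset_left)
  have hBC : (G.interedges B C).card + (Gᶜ.interedges B C).card = B.card * C.card :=
    G.card_interedges_add_card_interedges_compl
      ((dj S).mono Finset.inter_subset_left Finset.inter_subset_left)
  have hsum : A.card * D.card + B.card * C.card ≤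
      (G.interedges T Tᶜ).card + (Gᶜ.interedges S Sᶜ).card := by omega
  have bT : T.card * Tᶜ.card < Fintype.card V * (A.card * D.card + B.card * C.card) := by
    rw [cT, cT', hn]; nlinarith
  have bS : S.card * Sᶜ.card < Fintype.card V * (A.card * D.card + B.card * C.card) := by
    rw [cS, cS', hn]; exact arS
  generalize A.card * D.card + B.card * C.card = P at hsum bT bS
  rw [SimpleGraph.edgeDensity_def, SimpleGraph.edgeDensity_def]
  generalize (G.interedges T Tᶜ).card = p at hsum ⊢
  generalize (Gᶜ.interedges S Sᶜ).card = q at hsum ⊢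
  have hTpos : (0 : ℝ) < T.card * Tᶜ.card := by exact_mod_cast Nat.mul_pos pT pT'
  have hSpos : (0 : ℝ) < S.card * Sᶜ.card := by exact_mod_cast Nat.mul_pos pS pS'
  have hPpos : (0 : ℝ) < P := by
    have : 0 < P := Nat.pos_of_ne_zero (by rintro rfl; omega)
    exact_mod_cast this
  have bT' : (T.card * Tᶜ.card : ℝ) < Fintype.card V * P := by exact_mod_cast bT
  have bS' : (S.card * Sᶜ.card : ℝ) < Fintype.card V * P := by exact_mod_cast bS
  have hsum' : (P : ℝ) ≤ p + q := by exact_mod_cast hsum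
  push_cast
  -- Bounding both denominators by the larger one `M` only uses `p + q ≥ P > M / n`.
  set M : ℝ := max (T.card * Tᶜ.card) (S.card * Sᶜ.card) with hM
  have hMpos : 0 < M := lt_max_of_lt_left hTpos
  calc (1 : ℝ) < Fintype.card V * P / M := by
        rw [lt_div_iff₀ hMpos, one_mul]; exact max_lt bT' bS'
    _ ≤ Fintype.card V * (p / M + q / M) := by
        rw [← add_div, mul_div_assoc]; gcongr
    _ ≤ _ := by
        gcongr
        · exact le_max_left _ _
        · exact le_max_right _ _

/-! ### Graphs all of whose cuts have the same density -/

/-- In a connected graph that is not complete, the cuts do not all have the same density. -/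
theorem eq_top_of_edgeDensity_eq {V : Type*} [Fintype V] [DecidableEq V] [Nontrivial V]
    {G : SimpleGraph V} [DecidableRel G.Adj] (hG : G.Connected)
    (h : ∀ S T : Finset V, S.Nonempty → Sᶜ.Nonempty → T.Nonempty → Tᶜ.Nonempty →
      G.edgeDensity S Sᶜ = G.edgeDensity T Tᶜ) : G = ⊤ := by
  by_contra hne
  obtain ⟨u, v, huv, hadj⟩ := SimpleGraph.ne_top_iff_exists_not_adj.1 hne
  have hcompl : ∀ w : V, ({w}ᶜ : Finset V).Nonempty := fun w =>
    let ⟨z, hz⟩ := exists_ne w; ⟨z, by simpa using hz⟩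
  have hn2 : 2 ≤ Fintype.card V := Fintype.one_lt_card
  have hcard : ∀ w : V, ({w}ᶜ : Finset V).card = Fintype.card V - 1 := fun w => by
    simp [Finset.card_compl]
  have hpos : 0 < (G.interedges {u} {u}ᶜ).card := by
    obtain ⟨w, hw⟩ := hG.preconnected.exists_adj_of_nontrivial u
    exact Finset.card_pos.2 ⟨(u, w), by simp [SimpleGraph.mem_interedges_iff, hw, hw.ne']⟩
  have hpair : (G.interedges {u, v} {u, v}ᶜ).card
      = (G.interedges {u} {u}ᶜ).card + (G.interedges {v} {v}ᶜ).card := by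
    rw [← Finset.card_union_of_disjoint]
    · congr 1
      ext ⟨a, b⟩
      simp only [SimpleGraph.mem_interedges_iff, Finset.mem_union, Finset.mem_insert,
        Finset.mem_singleton, Finset.mem_compl, not_or]
      constructor
      · rintro ⟨rfl | rfl, ⟨h1, h2⟩, h3⟩
        · exact Or.inl ⟨rfl, h1, h3⟩
        · exact Or.inr ⟨rfl, h2, h3⟩
      · rintro (⟨rfl, h1, h3⟩ | ⟨rfl, h1, h3⟩)
        · exact ⟨Or.inl rfl, ⟨h1, fun e => hadj (e ▸ h3)⟩, h3⟩
        · exact ⟨Or.inr rfl, ⟨fun e => hadj (e ▸ h3.symm), h1⟩, h3⟩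
    · rw [Finset.disjoint_left]
      rintro ⟨a, b⟩ h1 h2
      simp only [SimpleGraph.mem_interedges_iff, Finset.mem_singleton] at h1 h2
      exact huv (h1.1.symm.trans h2.1)
  have hc2 : ({u, v}ᶜ : Finset V).card = Fintype.card V - 2 := by
    rw [Finset.card_compl, Finset.card_pair huv]
  have hv := h {u} {v} (by simp) (hcompl u) (by simp) (hcompl v)
  have hn1 : (0 : ℚ) < (Fintype.card V - 1 : ℕ) := by
    exact_mod_cast (by omega : 0 < Fintype.card V - 1)
  simp only [SimpleGraph.edgeDensity_def, hcard, Finset.card_singleton, Nat.cast_one,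
    one_mul] at hv
  rw [div_left_inj' hn1.ne', Nat.cast_inj] at hv
  have hle := G.card_interedges_le_mul {u, v} {u, v}ᶜ
  rw [hpair, hc2, Finset.card_pair huv] at hle
  -- The bound `hle` excludes `n = 2`, where `{u, v}` is not a cut.
  have hn3 : 0 < Fintype.card V - 2 := by omega
  have hp := h {u} {u, v} (by simp) (hcompl u) (by simp) (Finset.card_pos.1 (by omega))
  have hn2' : (0 : ℚ) < (Fintype.card V - 2 : ℕ) := by exact_mod_cast hn3
  rw [SimpleGraph.edgeDensity_def, SimpleGraph.edgeDensity_def, hpair, ← hv, hcard, hc2,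
    Finset.card_pair huv, Finset.card_singleton, div_eq_div_iff (by positivity) (by positivity)]
    at hp
  have hp' : (G.interedges {u} {u}ᶜ).card * (1 * 2 * (Fintype.card V - 2)) =
      (G.interedges {u} {u}ᶜ).card * (2 * (Fintype.card V - 1)) := by
    have : (G.interedges {u} {u}ᶜ).card * (2 * (Fintype.card V - 2)) =
      ((G.interedges {u} {u}ᶜ).card + (G.interedges {u} {u}ᶜ).card) *
        (1 * (Fintype.card V - 1)) := by exact_mod_cast hp
    linarith
  have := Nat.eq_of_mul_eq_mul_left hpos hp'
  omega

/-! ### The bounds for a graph and its complement -/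

theorem mainTheorem1 {V : Type*} [Fintype V] (n : ℕ) (hn : Fintype.card V = n) (hn2 : 2 ≤ n)
    (G : SimpleGraph V) (hG : G.Connected) :
    (1 / 2 : ℝ) < l1Fiedler G + l1Fiedler Gᶜ ∧
    l1Fiedler G + l1Fiedler Gᶜ ≤ (n : ℝ) / 2 ∧
    (l1Fiedler G + l1Fiedler Gᶜ = (n : ℝ) / 2 ↔
      Nonempty (G ≃g (⊤ : SimpleGraph (Fin n)))) := by
  classical
  subst hn
  have : Nontrivial V := Fintype.one_lt_card_iff_nontrivial.1 hn2
  have hnpos : (0 : ℝ) < Fintype.card V := by exact_mod_cast (by omega : 0 < Fintype.card V)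
  obtain ⟨T, hT, hT', hbT⟩ := exists_edgeDensity_le_l1Fiedler G
  obtain ⟨S, hS, hS', hbS⟩ := exists_edgeDensity_le_l1Fiedler Gᶜ
  have hadd : ∀ X : Finset V, X.Nonempty → Xᶜ.Nonempty →
      (G.edgeDensity X Xᶜ + Gᶜ.edgeDensity X Xᶜ : ℝ) = 1 := fun X hX hX' => by
    exact_mod_cast G.edgeDensity_add_edgeDensity_compl hX hX' disjoint_compl_right
  refine ⟨?_, ?_, ?_, ?_⟩
  · have := one_lt_card_mul_edgeDensity_add_compl G hS hS' hT hT'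
    linarith
  · have h1 := l1Fiedler_le_edgeDensity G hS hS'
    have h2 := l1Fiedler_le_edgeDensity Gᶜ hS hS'
    have h3 := hadd S hS hS'
    rw [eq_sub_of_add_eq h3] at h1
    linarith
  · intro heq
    -- `d_G(X, Xᶜ) + d_{Gᶜ}(Y, Yᶜ) ≥ 1` for all cuts, so `d_G(X, Xᶜ) ≥ d_G(Y, Yᶜ)`.
    have hle : ∀ X Y : Finset V, X.Nonempty → Xᶜ.Nonempty → Y.Nonempty → Yᶜ.Nonempty →
        G.edgeDensity Y Yᶜ ≤ G.edgeDensity X Xᶜ := fun X Y hX hX' hY hY' => by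
      have h1 := l1Fiedler_le_edgeDensity G hX hX'
      have h2 := l1Fiedler_le_edgeDensity Gᶜ hY hY'
      have h3 := hadd Y hY hY'
      have h4 : (Fintype.card V : ℝ) / 2 * G.edgeDensity Y Yᶜ ≤
          Fintype.card V / 2 * G.edgeDensity X Xᶜ := by
        rw [eq_sub_of_add_eq h3]; linarith
      exact_mod_cast le_of_mul_le_mul_left h4 (by positivity)
    obtain rfl := eq_top_of_edgeDensity_eq hG fun X Y hX hX' hY hY' =>
      le_antisymm (hle Y X hY hY' hX hX') (hle X Y hX hX' hY hY')
    exact ⟨SimpleGraph.Iso.completeGraph (Fintype.equivFin V)⟩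
  · rintro ⟨φ⟩
    have hadj : ∀ u v, G.Adj u v ↔ u ≠ v := fun u v => by
      rw [← φ.map_adj_iff, SimpleGraph.top_adj, φ.injective.ne_iff]
    have hbot : ∀ X : Finset V, Gᶜ.edgeDensity X Xᶜ = 0 := fun X => by
      rw [SimpleGraph.edgeDensity_def, Finset.card_eq_zero.2]
      · simp
      · ext; simp [SimpleGraph.mem_interedges_iff, hadj]
    have h1 := l1Fiedler_le_edgeDensity G hT hT'
    have h2 := l1Fiedler_le_edgeDensity Gᶜ hS hS'
    have h3 := hadd T hT hT'
    rw [hbot, Rat.cast_zero, mul_zero] at h2 hbS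
    rw [hbot, Rat.cast_zero, add_zero] at h3
    rw [h3, mul_one] at h1 hbT
    linarith
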